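/- Fix an integer $d>1$. For $n\ge 1$ and $r>0$ let $\mathcal G_d(n,r)$ be the random geometric graph with vertex set $\{1,\dots,n\}$: $n$ points are chosen independently and uniformly at random from $[0,1]^d$, and two distinct vertices are adjacent if and only if the Euclidean distance between their points is at most $r$. The game of Cops and Robbers on a finite graph $G$ is played as follows. First $k$ cops occupy vertices of $G$, then the robber chooses a vertex; after that, in each round the cops move first and the robber second, and a move consists of staying put or of walking along one edge. All positions are known to both sides. The cops win if at some moment a cop is on the same vertex as the robber. The cop number $c(G)$ is the least $k$ for which $k$ cops have a winning strategy on $G$. **Theorem.** For each fixed integer $d>1$ there are constants $c_d>0$ and $K_d>0$ such that the following holds. Let $r=r(n)$ be any sequence of reals such that $r(n)>0$ and $$r(n)^{3d-1}>c_d\,\frac{\log n}{n}$$ for all sufficiently large $n$. Then, with probability tending to $1$ as $n\to\infty$, $c(\mathcal G_d(n,r(n)))=1$. Moreover, with probability tending to $1$ as $n\to\infty$, a single cop has a strategy on $\mathcal G_d(n,r(n))$ that catches every robber within $\lceil K_d/r(n)^2\rceil$ rounds. -/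

import Mathlib

open Filter Topology MeasureTheory

/-! ## The game of Cops and Robbers on a graph -/

namespace CopsRobbers

/-- A legal move of one player on the graph `G`: stay put, or walk along an edge. -/
def Step {V : Type*} (G : SimpleGraph V) (u v : V) : Prop :=
  v = u ∨ G.Adj u v

/-- A (deterministic, full-information) strategy for `k` cops on `G`.
`pos t h i` is the vertex of cop `i` after his `t`-th move, when the robber's positions seen
so far are `h 0, …, h (t - 1)`: `h 0` is the vertex where the robber started, and `h j` is his
position after his `j`-th move. In particular `pos 0` is the initial placement of the cops, which
is made before the robber has chosen his vertex. Two consecutive positions of a cop are always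
joined by a legal move. -/
structure CopStrategy {V : Type*} (G : SimpleGraph V) (k : ℕ) where
  pos : (t : ℕ) → (Fin t → V) → Fin k → V
  legal : ∀ (t : ℕ) (h : Fin (t + 1) → V) (i : Fin k),
    Step G (pos t (fun j : Fin t => h j.castSucc) i) (pos (t + 1) h i)

/-- A legal trajectory of the robber: `ρ 0` is the starting vertex, which he chooses freely,
and `ρ t` is his position after his `t`-th move. -/
def IsRobberPath {V : Type*} (G : SimpleGraph V) (ρ : ℕ → V) : Prop :=
  ∀ t, Step G (ρ t) (ρ (t + 1))

/-- Positions of the cops after their `t`-th move, if they follow `s` against the trajectory `ρ`.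
They depend only on `ρ 0, …, ρ (t - 1)`. -/
def CopStrategy.run {V : Type*} {G : SimpleGraph V} {k : ℕ} (s : CopStrategy G k)
    (ρ : ℕ → V) (t : ℕ) : Fin k → V :=
  s.pos t (fun j : Fin t => ρ j)

/-- The robber is caught by the end of round `T`. Round `0` is the placement of the cops and then
of the robber; in each later round the cops move first and the robber second. A capture occurs
when some cop and the robber are on the same vertex, either at the end of a round `t ≤ T` or
after the cops' move in a round `t + 1 ≤ T`. -/
def CaughtWithin {V : Type*} {G : SimpleGraph V} {k : ℕ} (s : CopStrategy G k)
    (ρ : ℕ → V) (T : ℕ) : Prop :=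
  (∃ t, t ≤ T ∧ ∃ i, s.run ρ t i = ρ t) ∨ (∃ t, t + 1 ≤ T ∧ ∃ i, s.run ρ (t + 1) i = ρ t)

/-- `k` cops have a winning strategy on `G`: every robber is eventually caught. -/
def CopsWin {V : Type*} (G : SimpleGraph V) (k : ℕ) : Prop :=
  ∃ s : CopStrategy G k, ∀ ρ : ℕ → V, IsRobberPath G ρ → ∃ T, CaughtWithin s ρ T

/-- `k` cops have a strategy on `G` that catches every robber within `T` rounds. -/
def CopsWinWithin {V : Type*} (G : SimpleGraph V) (k T : ℕ) : Prop :=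
  ∃ s : CopStrategy G k, ∀ ρ : ℕ → V, IsRobberPath G ρ → CaughtWithin s ρ T

/-- The cop number of a (finite) graph: the least number of cops that have a winning strategy. -/
noncomputable def copNumber {V : Type*} (G : SimpleGraph V) : ℕ :=
  sInf {k : ℕ | CopsWin G k}

end CopsRobbers

/-! ## Random geometric graphs -/

namespace RandomGeometric

/-- The cube `[0,1]^d` in Euclidean `d`-space. -/
def unitCube (d : ℕ) : Set (EuclideanSpace ℝ (Fin d)) :=
  {x | ∀ i, x i ∈ Set.Icc (0 : ℝ) 1}

/-- The uniform distribution on `[0,1]^d` (the cube has volume `1`). -/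
noncomputable def uniformCube (d : ℕ) : Measure (EuclideanSpace ℝ (Fin d)) :=
  volume.restrict (unitCube d)

instance isProbabilityMeasure_uniformCube (d : ℕ) : IsProbabilityMeasure (uniformCube d) := by
  have hv : volume (unitCube d) = 1 := by
    have h := (EuclideanSpace.volume_preserving_symm_measurableEquiv_toLp (Fin d))
    have e : unitCube d = (MeasurableEquiv.toLp 2 (Fin d → ℝ)).symm ⁻¹'
        (Set.univ.pi fun _ : Fin d => Set.Icc (0 : ℝ) 1) := by
      ext x
      simp [unitCube, Pi.le_def, forall_and]
    rw [e, h.measure_preimage_equiv, volume_pi, Measure.pi_pi]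
    simp
  exact ⟨by rw [uniformCube, Measure.restrict_apply_univ, hv]⟩

/-- The law of `n` independent uniform points of `[0,1]^d`. -/
noncomputable def pointsLaw (d n : ℕ) : Measure (Fin n → EuclideanSpace ℝ (Fin d)) :=
  Measure.pi fun _ : Fin n => uniformCube d

/-- The geometric graph of the points `X 0, …, X (n - 1)`: two distinct vertices are adjacent when
the Euclidean distance of their points is at most `r`. If `X` has law `pointsLaw d n`, this is
the random geometric graph with `n` vertices and radius `r`. -/
def geometricGraph {d n : ℕ} (X : Fin n → EuclideanSpace ℝ (Fin d)) (r : ℝ) :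
    SimpleGraph (Fin n) where
  Adj i j := i ≠ j ∧ dist (X i) (X j) ≤ r
  symm := ⟨fun i j h => ⟨h.1.symm, by rw [dist_comm]; exact h.2⟩⟩
  loopless := ⟨fun _ h => h.1 rfl⟩

end RandomGeometric

/-!
A single cop wins by guarding the ray from a vertex `o` near the centre of the cube to the robber.
He starts at `o`, and then tries to stay on the segment from `o` to the robber while his distance
from `o` increases. In the absence of errors: if the cop is at a point `c` of this segment, and the
robber moves by at most `r` to a point `q` out of the cop's reach `r`, then `q` is beyond the
hyperplane through `c` orthogonal to the segment, and so the angle `θ` of his ray to the old one has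
`tan θ ≤ r / |c - o|`. Hence every point of the new ray at a distance from `o` of at most
`√(|c - o| ^ 2 + r ^ 2)` that is not nearer to `o` than `c` is in the cop's reach, and the cop
can gain `r ^ 2` in the square of his distance from `o`. As the cube is bounded, the robber is caught
in `O(1 / r ^ 2)` rounds.

The cop has to move to vertices. If he gives up a quarter of the gain, the above leaves slack of order
`r ^ 2` along the ray and of order `r ^ 3` orthogonally to it, so that he may go to any point of
a cylinder of volume of order `r ^ (3 * d - 1)` (`advance_of_shadowed`,
`exists_cylinder_subset_advanceRegion`). An off-line error could let a robber right next to the cop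
slip behind him, so the cop also stays a distance of order `r ^ 2` short of the robber; with this gap,
the cop's advantage survives the robber's next move (`shadowed_of_robber_move`). Because `o` is
central, the cylinder is inside the cube (`le_uniformCube_advanceRegion`).

The cylinder is determined by the three vertices `o`, `c`, `q`. Given their points, the other
`n - 3` are still independent and uniform, so a union bound over the triples shows that with
probability at least `1 - n ^ 3 * (1 - p) ^ (n - 3)`, for `p` of order `r ^ (3 * d - 1)`, every such
cylinder contains a vertex (`pointsLaw_not_advanceHits_le`), and this tends to `1` if `p` is at least
`8 * log n / n`. On this event the strategy works (`copsWinWithin_geometricGraph`).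
-/

/-! ### One round of the pursuit in an inner product space -/

namespace RandomGeometric

open scoped RealInnerProductSpace

section Pursuit

variable {E : Type*} [NormedAddCommGroup E] [InnerProductSpace ℝ E]

/-- The cop at `c` shadows the robber at `q`, seen from the origin: some point `c₀` within `β` of
`c` lies behind `q` (the projection of `q` to the line through `0` and `c₀` is at least as far
along it as `c₀`), and `q` is within `r` of that line. The distance of `q` from the line enters
multiplied by `‖c₀‖ ^ 2`, so that the condition is void for `c₀ = 0`, where the cop starts. -/
def Shadowed (r β : ℝ) (c q : E) : Prop :=
  ∃ c₀ : E, ‖c - c₀‖ ≤ β ∧ ‖c₀‖ ^ 2 ≤ ⟪q, c₀⟫ ∧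
    ‖c₀‖ ^ 2 * ‖q‖ ^ 2 - ⟪q, c₀⟫ ^ 2 ≤ r ^ 2 * ‖c₀‖ ^ 2

lemma shadowed_zero {r β : ℝ} (hβ : 0 ≤ β) (q : E) : Shadowed r β 0 q :=
  ⟨0, by simpa using hβ, by simp, by simp⟩

/-- If the cop at `x` is within `β` of the line from the origin to the robber `q`, at least `y`
short of him, then he still shadows the robber after a move of the latter to a point `q'` out of
the cop's reach. The gap `y` is essential: it is what makes an off-line error of order
`y ^ 2 / r` harmless, since a robber right next to the cop could use the error to slip behind. -/
lemma shadowed_of_robber_move {r β y : ℝ} {x q q' : E} (hβ : 0 ≤ β) (hβr : β ≤ r) (hy : 0 < y)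
    (hyβ : 2 * r * β ≤ y ^ 2) (hq : q ≠ 0)
    (hline : ‖x‖ ^ 2 * ‖q‖ ^ 2 - ⟪x, q⟫ ^ 2 ≤ β ^ 2 * ‖q‖ ^ 2) (h0 : 0 ≤ ⟪x, q⟫)
    (hm : ⟪x, q⟫ ≤ ‖q‖ * (‖q‖ - y)) (hmove : ‖q' - q‖ ≤ r) (hfar : r < ‖q' - x‖) :
    Shadowed r β x q' := by
  have hm0 : 0 < ‖q‖ := norm_pos_iff.2 hq
  obtain ⟨u, hu, hqu⟩ : ∃ u : E, ‖u‖ = 1 ∧ q = ‖q‖ • u :=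
    ⟨‖q‖⁻¹ • q, by rw [norm_smul, norm_inv, norm_norm, inv_mul_cancel₀ hm0.ne'],
      by rw [smul_smul, mul_inv_cancel₀ hm0.ne', one_smul]⟩
  set m := ‖q‖
  set s : ℝ := ⟪x, u⟫ with hs
  have hxq : ⟪x, q⟫ = m * s := by rw [hqu, inner_smul_right]
  have hs0 : 0 ≤ s := by
    rw [hxq] at h0; exact nonneg_of_mul_nonneg_right h0 hm0
  have hsm : s ≤ m - y := by
    rw [hxq] at hm; exact le_of_mul_le_mul_left hm hm0
  have hxs : ‖x - s • u‖ ^ 2 = ‖x‖ ^ 2 - s ^ 2 := by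
    rw [norm_sub_sq_real, inner_smul_right, norm_smul, hu, Real.norm_eq_abs, mul_one, sq_abs, ← hs]
    ring
  have hxβ : ‖x - s • u‖ ≤ β := by
    apply le_of_sq_le_sq _ hβ
    rw [hxs]
    rw [hxq] at hline
    have : (‖x‖ ^ 2 - s ^ 2) * m ^ 2 ≤ β ^ 2 * m ^ 2 := by linarith
    exact le_of_mul_le_mul_right this (by positivity)
  set l : ℝ := ⟪q', u⟫ with hl
  have hq's : ‖q' - s • u‖ ^ 2 = ‖q'‖ ^ 2 - 2 * (s * l) + s ^ 2 := by
    rw [norm_sub_sq_real, inner_smul_right, norm_smul, hu, Real.norm_eq_abs, mul_one, sq_abs, ← hl]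
  have hq'q : ‖q' - q‖ ^ 2 = ‖q'‖ ^ 2 - 2 * (m * l) + m ^ 2 := by
    rw [norm_sub_sq_real, hqu, inner_smul_right, norm_smul, hu, Real.norm_eq_abs, mul_one, sq_abs,
      ← hl]
  have hq'c : r - β < ‖q' - s • u‖ := by
    have : ‖q' - x‖ ≤ ‖q' - s • u‖ + ‖x - s • u‖ := by
      rw [norm_sub_rev x (s • u)]
      exact norm_sub_le_norm_sub_add_norm_sub _ _ _
    linarith
  have h1 : (r - β) ^ 2 ≤ ‖q' - s • u‖ ^ 2 := pow_le_pow_left₀ (by linarith) hq'c.le 2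
  have h2 : ‖q' - q‖ ^ 2 ≤ r ^ 2 := pow_le_pow_left₀ (norm_nonneg _) hmove 2
  -- Compare the distances of `q'` to `s • u` and to `m • u`: their squares differ by
  -- `2 * (m - s) * l - (m ^ 2 - s ^ 2)`, which is at least `-2 * r * β ≥ -(m - s) ^ 2`.
  have hls : s ≤ l := by
    have hk : y ^ 2 ≤ (m - s) ^ 2 := pow_le_pow_left₀ hy.le (by linarith) 2
    have : 0 ≤ (m - s) * (l - s) := by nlinarith [sq_nonneg β]
    have := nonneg_of_mul_nonneg_right this (by linarith : 0 < m - s)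
    linarith
  have hT : ‖q'‖ ^ 2 - l ^ 2 ≤ r ^ 2 := by nlinarith [sq_nonneg (l - m)]
  have hn : ‖s • u‖ ^ 2 = s ^ 2 := by
    rw [norm_smul, hu, mul_one, Real.norm_eq_abs, sq_abs]
  refine ⟨s • u, hxβ, ?_, ?_⟩
  · rw [hn, inner_smul_right, ← hl]; nlinarith
  · rw [hn, inner_smul_right, ← hl]; nlinarith [mul_le_mul_of_nonneg_left hT (sq_nonneg s)]

/-- For a shadowed robber out of the cop's reach, the squared distance from the origin exceeds that
of `c₀` by `r ^ 2`, up to an error from the distance of `c₀` to the cop. -/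
lemma norm_sq_add_le_of_shadow {r β : ℝ} {c q : E} (hβr : β ≤ r)
    {c₀ : E} (hc : ‖c - c₀‖ ≤ β) (hin : ‖c₀‖ ^ 2 ≤ ⟪q, c₀⟫) (hfar : r < ‖q - c‖) :
    ‖c₀‖ ^ 2 + r ^ 2 - 2 * r * β ≤ ‖q‖ ^ 2 := by
  have h : r - β ≤ ‖q - c₀‖ := by
    have : ‖q - c‖ ≤ ‖q - c₀‖ + ‖c - c₀‖ := by
      rw [norm_sub_rev c c₀]
      exact norm_sub_le_norm_sub_add_norm_sub _ _ _
    linarith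
  have h1 : (r - β) ^ 2 ≤ ‖q - c₀‖ ^ 2 := pow_le_pow_left₀ (by linarith) h 2
  rw [norm_sub_sq_real] at h1
  nlinarith [sq_nonneg β]

/-- In the plane, let a point at distance `A` from the origin have projection `a` to a ray whose
angle with it has tangent at most `r / A`. The points of the ray at distance
`s = √(A ^ 2 + e * r ^ 2)` from the origin are then within `r` of the given point, with room to
spare of order `r ^ 4 / (A ^ 2 + r ^ 2)` in the squared distance, as long as `e` stays away from `0`
and `1`. -/
lemma chord_bound {A r e a s : ℝ} (hr : 0 < r) (ha0 : 0 ≤ a) (hs0 : 0 ≤ s)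
    (he0 : 1 / 4 ≤ e) (he1 : e ≤ 3 / 4)
    (ha : A ^ 4 ≤ a ^ 2 * (A ^ 2 + r ^ 2)) (hs : s ^ 2 = A ^ 2 + e * r ^ 2) :
    s ^ 2 - 2 * a * s + A ^ 2 ≤ r ^ 2 - 3 / 16 * (r ^ 4 / (A ^ 2 + r ^ 2)) := by
  have hN : 0 < A ^ 2 + r ^ 2 := by positivity
  -- With `s ^ 2 = (1 - x) * (A ^ 2 + r ^ 2)`, the estimate rests on
  -- `√(1 - x) ≥ (1 - x) * (1 + x / 2)`.
  obtain ⟨x, hx⟩ : ∃ x, x = (1 - e) * (r ^ 2 / (A ^ 2 + r ^ 2)) := ⟨_, rfl⟩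
  have hR0 : 0 < r ^ 2 / (A ^ 2 + r ^ 2) := by positivity
  have hR1 : r ^ 2 / (A ^ 2 + r ^ 2) ≤ 1 := by rw [div_le_one hN]; nlinarith
  have hx0 : 0 ≤ x := by rw [hx]; apply mul_nonneg <;> linarith
  have hx1 : x ≤ 1 := by rw [hx]; nlinarith
  have hxN : x * (A ^ 2 + r ^ 2) = (1 - e) * r ^ 2 := by rw [hx]; field_simp
  have hEN : s ^ 2 = (1 - x) * (A ^ 2 + r ^ 2) := by rw [hs]; linarith
  have has : A ^ 2 * ((1 - x) * (1 + x / 2)) ≤ a * s := by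
    apply le_of_sq_le_sq _ (by positivity)
    have h1 : ((1 - x) * (1 + x / 2)) ^ 2 ≤ 1 - x := by
      have : 1 - x - ((1 - x) * (1 + x / 2)) ^ 2 = (1 - x) * (x ^ 2 * (3 + x) / 4) := by ring
      have h2 : 0 ≤ (1 - x) * (x ^ 2 * (3 + x) / 4) := by
        apply mul_nonneg (by linarith); positivity
      linarith
    calc (A ^ 2 * ((1 - x) * (1 + x / 2))) ^ 2 = A ^ 4 * ((1 - x) * (1 + x / 2)) ^ 2 := by ring
      _ ≤ A ^ 4 * (1 - x) := by gcongr
      _ ≤ a ^ 2 * (A ^ 2 + r ^ 2) * (1 - x) := by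
          apply mul_le_mul_of_nonneg_right ha; linarith
      _ = (a * s) ^ 2 := by rw [mul_pow, hEN]; ring
  have key : A ^ 2 * x * (1 + x) ≤ (1 - e) * r ^ 2 - 3 / 16 * (r ^ 4 / (A ^ 2 + r ^ 2)) := by
    set R := r ^ 2 / (A ^ 2 + r ^ 2) with hR
    have hAR : A ^ 2 * R = r ^ 2 * (1 - R) := by rw [hR]; field_simp; ring
    have hr4 : r ^ 4 / (A ^ 2 + r ^ 2) = r ^ 2 * R := by rw [hR]; field_simp
    have : A ^ 2 * x * (1 + x) = r ^ 2 * ((1 - R) * (1 - e) * (1 + (1 - e) * R)) := by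
      rw [hx]; linear_combination ((1 - e) * (1 + (1 - e) * R)) * hAR
    rw [hr4, this]
    have : (1 - R) * (1 - e) * (1 + (1 - e) * R) ≤ (1 - e) - 3 / 16 * R := by
      nlinarith [mul_nonneg (sub_nonneg.2 he0) (sub_nonneg.2 he1), mul_nonneg hR0.le
        (mul_nonneg (sub_nonneg.2 he0) (sub_nonneg.2 he1)),
        mul_nonneg (sq_nonneg R) (sq_nonneg (1 - e))]
    nlinarith [mul_le_mul_of_nonneg_left this (sq_nonneg r)]
  nlinarith

/-- A lower bound for a difference of two lengths at most `D` from one for their squares. -/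
lemma le_of_sq_sub {D s t k : ℝ} (hD : 0 < D) (hs : s ≤ D) (ht' : t ≤ D) (hst : t ≤ s)
    (h : 2 * D * k ≤ s ^ 2 - t ^ 2) : k ≤ s - t := by
  have : 2 * D * k ≤ 2 * D * (s - t) := by nlinarith
  exact le_of_mul_le_mul_left this (by positivity)

/-- Let `A` be the distance of a point `c₀` from the origin, `a` its projection to the ray through
`q` and `m = ‖q‖`. If `c₀` shadows `q`, then `c₀` is within `r` of the ray, and its angle with the
ray has tangent at most `r / A`. -/
lemma foot_bounds {A a m r : ℝ} (hA : 0 ≤ A) (ha : 0 ≤ a) (haA : a ≤ A) (hm : 0 < m) (hAm : A ≤ m)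
    (hin : A ^ 2 ≤ m * a) (hT : A ^ 2 * m ^ 2 - (m * a) ^ 2 ≤ r ^ 2 * A ^ 2) :
    A ^ 2 - a ^ 2 ≤ r ^ 2 ∧ A ^ 4 ≤ a ^ 2 * (A ^ 2 + r ^ 2) := by
  constructor
  · have h2 : r ^ 2 * A ^ 2 ≤ r ^ 2 * m ^ 2 := by gcongr
    have h1 : m ^ 2 * (A ^ 2 - a ^ 2) ≤ m ^ 2 * r ^ 2 := by linarith
    exact le_of_mul_le_mul_left h1 (by positivity)
  · rcases hA.eq_or_lt with h | h
    · rw [← h, zero_pow (by norm_num)]; positivity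
    · have h0 : 0 ≤ A ^ 2 - a ^ 2 := sub_nonneg.2 (pow_le_pow_left₀ ha haA 2)
      have h1 : (A ^ 2) ^ 2 ≤ (m * a) ^ 2 := pow_le_pow_left₀ (sq_nonneg A) hin 2
      have h2 : A ^ 2 * A ^ 4 ≤ A ^ 2 * (a ^ 2 * (A ^ 2 + r ^ 2)) := by
        have h3 : a ^ 2 * (A ^ 2 * m ^ 2 - (m * a) ^ 2) ≤ a ^ 2 * (r ^ 2 * A ^ 2) := by gcongr
        have h4 := mul_le_mul_of_nonneg_right h1 h0
        linarith
      exact le_of_mul_le_mul_left h2 (by positivity)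

/-- The cop's move. Let the cop at `c` shadow the robber at `q = m • u`, out of his reach. The points
of the ray at distance `s` from the origin, where `s ^ 2 - ‖c₀‖ ^ 2` is between `r ^ 2 / 4` and
`3 * r ^ 2 / 4`, and all points within `β` of them in a direction `τ` orthogonal to the ray, can be
reached by the cop, are further out than `c` by order `r ^ 2`, and keep a gap of order `r ^ 2`
to the robber. -/
lemma advance_of_shadowed {r D β : ℝ} {c q u c₀ τ : E} {m s : ℝ}
    (hr : 0 < r) (hrD : r ≤ D) (hD : 1 ≤ D)
    (hβ : β = r ^ 3 / (1024 * D ^ 3)) (hu : ‖u‖ = 1) (hqu : q = m • u) (hm0 : 0 < m) (hmD : m ≤ D)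
    (hc : ‖c - c₀‖ ≤ β) (hin : ‖c₀‖ ^ 2 ≤ ⟪q, c₀⟫)
    (hT : ‖c₀‖ ^ 2 * ‖q‖ ^ 2 - ⟪q, c₀⟫ ^ 2 ≤ r ^ 2 * ‖c₀‖ ^ 2)
    (hfar : r < ‖q - c‖) (hs0 : 0 ≤ s)
    (hs1 : ‖c₀‖ ^ 2 + 1 / 4 * r ^ 2 ≤ s ^ 2) (hs2 : s ^ 2 ≤ ‖c₀‖ ^ 2 + 3 / 4 * r ^ 2)
    (hτu : ⟪τ, u⟫ = 0) (hτ : ‖τ‖ ≤ β) :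
    ‖s • u + τ - c‖ ≤ r ∧ ‖c‖ + r ^ 2 / (16 * D) ≤ ‖s • u + τ‖ ∧ s ≤ m - r ^ 2 / (16 * D) := by
  have hD0 : 0 < D := by linarith
  have hβ0 : 0 ≤ β := by rw [hβ]; positivity
  have hβ1 : β ≤ r ^ 2 / (1024 * D) := by
    rw [hβ, div_le_div_iff₀ (by positivity) (by positivity)]
    have h1 : r ≤ D ^ 2 := by nlinarith
    have : r ^ 3 * (1024 * D) = 1024 * r ^ 2 * D * r := by ring
    rw [this]
    calc 1024 * r ^ 2 * D * r ≤ 1024 * r ^ 2 * D * D ^ 2 := by gcongr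
      _ = _ := by ring
  have hrr : r ^ 2 / (1024 * D) ≤ r / 1024 := by
    rw [div_le_div_iff₀ (by positivity) (by positivity)]; nlinarith
  have hβr : β ≤ r / 1024 := hβ1.trans hrr
  have hβ4 : 64 * r * β ≤ r ^ 4 / (16 * D ^ 2) := by
    rw [hβ, mul_div_assoc', div_le_div_iff₀ (by positivity) (by positivity)]
    have : D ^ 2 ≤ D ^ 3 := pow_le_pow_right₀ hD (by norm_num)
    have h3 : r ^ 4 * D ^ 2 ≤ r ^ 4 * D ^ 3 := by gcongr
    nlinarith
  have huu : ⟪u, u⟫ = 1 := by rw [real_inner_self_eq_norm_sq, hu]; norm_num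
  have hqm : ‖q‖ = m := by rw [hqu, norm_smul, hu, mul_one, Real.norm_of_nonneg hm0.le]
  set A := ‖c₀‖ with hA
  have hA0 : 0 ≤ A := norm_nonneg _
  set a : ℝ := ⟪c₀, u⟫ with ha
  have hqc : ⟪q, c₀⟫ = m * a := by rw [hqu, inner_smul_left, real_inner_comm]; rfl
  rw [hqc] at hin hT
  rw [hqm] at hT
  have haA : a ≤ A := by
    have := real_inner_le_norm c₀ u
    rwa [hu, mul_one] at this
  have ha0 : 0 ≤ a := nonneg_of_mul_nonneg_right (le_trans (sq_nonneg A) hin) hm0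
  have hAm : A ≤ m := by
    rcases hA0.eq_or_lt with h | h
    · linarith
    · have : A * A ≤ A * m := by nlinarith
      exact le_of_mul_le_mul_left this h
  have hbig := norm_sq_add_le_of_shadow (by linarith) hc (by rw [hqc]; exact hin) hfar
  rw [hqm, ← hA] at hbig
  obtain ⟨hh, ha4⟩ := foot_bounds hA0 ha0 haA hm0 hAm hin hT
  obtain ⟨e, he⟩ : ∃ e, e = (s ^ 2 - A ^ 2) / r ^ 2 := ⟨_, rfl⟩
  have her : s ^ 2 = A ^ 2 + e * r ^ 2 := by rw [he]; field_simp; ring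
  have hr2 : 0 < r ^ 2 := by positivity
  have he0 : 1 / 4 ≤ e := by rw [he, le_div_iff₀ hr2]; linarith
  have he1 : e ≤ 3 / 4 := by rw [he, div_le_iff₀ hr2]; linarith
  have hch := chord_bound hr ha0 hs0 he0 he1 ha4 her
  have hAs : A ≤ s := le_of_sq_le_sq (by linarith) hs0
  have hms : 2 * D * (r ^ 2 / (16 * D)) ≤ m ^ 2 - s ^ 2 := by
    have : 2 * D * (r ^ 2 / (16 * D)) = r ^ 2 / 8 := by field_simp; ring
    have hrβ : r * β ≤ r * (r / 1024) := by gcongr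
    rw [this]; linarith
  have hsm' : s ≤ m := le_of_sq_le_sq (by have : 0 ≤ 2 * D * (r ^ 2 / (16 * D)) := by positivity
                                          linarith) hm0.le
  have hsm := le_of_sq_sub hD0 hmD (hsm'.trans hmD) hsm' hms
  have hsA : r ^ 2 / (8 * D) ≤ s - A := by
    apply le_of_sq_sub hD0 (hsm'.trans hmD) (hAm.trans hmD) hAs
    have : 2 * D * (r ^ 2 / (8 * D)) = r ^ 2 / 4 := by field_simp; ring
    rw [this]; linarith
  refine ⟨?_, ?_, by linarith⟩
  · -- Only the component `c₀ - a • u` of `c₀` orthogonal to the ray, of norm at most `r`,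
    -- contributes to `⟪τ, c₀⟫`.
    have hτc : |⟪τ, c₀⟫| ≤ β * r := by
      have h1 : ⟪τ, c₀⟫ = ⟪τ, c₀ - a • u⟫ := by
        rw [inner_sub_right, inner_smul_right, hτu, mul_zero, sub_zero]
      have h2 : ‖c₀ - a • u‖ ^ 2 = A ^ 2 - a ^ 2 := by
        rw [norm_sub_sq_real, inner_smul_right, norm_smul, hu, Real.norm_eq_abs, mul_one, sq_abs,
          ← ha]
        ring
      have h3 : ‖c₀ - a • u‖ ≤ r := le_of_sq_le_sq (by rw [h2]; exact hh) hr.le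
      rw [h1]
      exact (abs_real_inner_le_norm _ _).trans (mul_le_mul hτ h3 (norm_nonneg _) hβ0)
    have hx : ‖s • u + τ - c₀‖ ≤ r - β := by
      apply le_of_sq_le_sq _ (by linarith)
      have h1 : ‖s • u + τ - c₀‖ ^ 2 = s ^ 2 - 2 * a * s + A ^ 2 + ‖τ‖ ^ 2 - 2 * ⟪τ, c₀⟫ := by
        rw [norm_sub_sq_real, norm_add_sq_real, inner_add_left, inner_smul_left, inner_smul_left,
          real_inner_comm τ u, hτu, real_inner_comm c₀ u, ← ha, norm_smul, hu, Real.norm_eq_abs,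
          mul_one, sq_abs]
        simp only [conj_trivial]
        ring
      have h2 : ‖τ‖ ^ 2 ≤ β ^ 2 := pow_le_pow_left₀ (norm_nonneg _) hτ 2
      have h3 : r ^ 4 / (2 * D ^ 2) ≤ r ^ 4 / (A ^ 2 + r ^ 2) := by
        apply div_le_div_of_nonneg_left (by positivity) (by positivity)
        have h5 : A ^ 2 ≤ D ^ 2 := pow_le_pow_left₀ hA0 (hAm.trans hmD) 2
        have h6 : r ^ 2 ≤ D ^ 2 := pow_le_pow_left₀ hr.le hrD 2
        linarith
      have h4 : r ^ 4 / (2 * D ^ 2) = 8 * (r ^ 4 / (16 * D ^ 2)) := by field_simp; ring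
      have h5 := neg_le_of_abs_le hτc
      have h6 : 0 ≤ r * β := by positivity
      rw [h1]
      linarith
    have : ‖s • u + τ - c‖ ≤ ‖s • u + τ - c₀‖ + ‖c - c₀‖ := by
      rw [norm_sub_rev c c₀]
      exact norm_sub_le_norm_sub_add_norm_sub _ _ _
    linarith
  · have h1 : s ≤ ‖s • u + τ‖ := by
      have := real_inner_le_norm (s • u + τ) u
      rwa [inner_add_left, inner_smul_left, huu, hτu, hu, add_zero, mul_one, mul_one] at this
    have h2 : ‖c‖ ≤ A + β := by
      have := norm_add_le c₀ (c - c₀)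
      rw [add_sub_cancel] at this
      linarith
    have h3 : r ^ 2 / (8 * D) = 2 * (r ^ 2 / (16 * D)) := by field_simp; ring
    have h4 : r ^ 2 / (1024 * D) ≤ r ^ 2 / (16 * D) := by gcongr; norm_num
    linarith

end Pursuit

/-! ### The region of good moves contains a cylinder -/

section Region

variable {E : Type*} [NormedAddCommGroup E] [InnerProductSpace ℝ E]

/-- The points to which a cop at `c` may well move when the robber is at `q`, as seen from `o`: they
are within `r` of `c`, further from `o` than `c` by `r ^ 2 / (16 * D)`, within
`r ^ 3 / (1024 * D ^ 3)` of the line from `o` to `q`, and project to it between `o` and the point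
`r ^ 2 / (16 * D)` short of `q`. The last conditions are written as polynomial inequalities, which
makes the region visibly closed, jointly in all points. -/
def advanceRegion (r D : ℝ) (o c q : E) : Set E :=
  {x | ‖x - c‖ ≤ r ∧ ‖c - o‖ + r ^ 2 / (16 * D) ≤ ‖x - o‖ ∧
    ‖x - o‖ ^ 2 * ‖q - o‖ ^ 2 - ⟪x - o, q - o⟫ ^ 2 ≤ (r ^ 3 / (1024 * D ^ 3)) ^ 2 * ‖q - o‖ ^ 2 ∧
    0 ≤ ⟪x - o, q - o⟫ ∧ ⟪x - o, q - o⟫ ≤ ‖q - o‖ * (‖q - o‖ - r ^ 2 / (16 * D))}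

lemma tubeRadius_le {r D : ℝ} (hr : 0 < r) (hrD : r ≤ D) (hD : 1 ≤ D) :
    r ^ 3 / (1024 * D ^ 3) ≤ r / 1024 := by
  rw [div_le_div_iff₀ (by positivity) (by positivity)]
  have h1 : r ^ 2 ≤ D ^ 3 :=
    (pow_le_pow_left₀ hr.le hrD 2).trans (pow_le_pow_right₀ hD (by norm_num))
  calc r ^ 3 * 1024 = r * (1024 * r ^ 2) := by ring
    _ ≤ r * (1024 * D ^ 3) := by gcongr

lemma pos_norm_of_shadowed {r D : ℝ} {c q : E} (hr : 0 < r) (hrD : r ≤ D) (hD : 1 ≤ D)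
    (h : Shadowed r (r ^ 3 / (1024 * D ^ 3)) c q) (hfar : r < ‖q - c‖) : 0 < ‖q‖ := by
  obtain ⟨c₀, hc, hin, -⟩ := h
  have hβ := tubeRadius_le hr hrD hD
  have hb := norm_sq_add_le_of_shadow (by linarith) hc hin hfar
  have h1 : r * (r ^ 3 / (1024 * D ^ 3)) ≤ r * (r / 1024) := by gcongr
  have h2 : 0 < ‖q‖ ^ 2 := by
    have : 0 < r * r := by positivity
    have := sq_nonneg ‖c₀‖
    linarith
  by_contra hn
  have : ‖q‖ = 0 := le_antisymm (not_lt.1 hn) (norm_nonneg _)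
  rw [this] at h2; norm_num at h2

/-- When the robber is shadowed and out of reach, the region of good moves contains a cylinder around
the ray to the robber, of length at least `r ^ 2 / (4 * D)` and radius `r ^ 3 / (1024 * D ^ 3)`. -/
lemma exists_cylinder_subset_advanceRegion {r D : ℝ} {o c q : E} (hr : 0 < r) (hrD : r ≤ D)
    (hD : 1 ≤ D) (hqD : ‖q - o‖ ≤ D)
    (h : Shadowed r (r ^ 3 / (1024 * D ^ 3)) (c - o) (q - o)) (hfar : r < ‖q - c‖) :
    ∃ (u : E) (m s₁ s₂ : ℝ), ‖u‖ = 1 ∧ 0 < m ∧ m ≤ D ∧ q = o + m • u ∧ 0 ≤ s₁ ∧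
      r ^ 2 / (4 * D) ≤ s₂ - s₁ ∧ s₂ ≤ m - r ^ 2 / (16 * D) ∧
      ∀ s ∈ Set.Icc s₁ s₂, ∀ τ : E, ⟪τ, u⟫ = 0 → ‖τ‖ ≤ r ^ 3 / (1024 * D ^ 3) →
        o + (s • u + τ) ∈ advanceRegion r D o c q := by
  have hD0 : 0 < D := by linarith
  have hfar' : r < ‖(q - o) - (c - o)‖ := by rwa [sub_sub_sub_cancel_right]
  have hm0 := pos_norm_of_shadowed hr hrD hD h hfar'
  obtain ⟨u, hu, hqu⟩ : ∃ u : E, ‖u‖ = 1 ∧ q - o = ‖q - o‖ • u :=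
    ⟨‖q - o‖⁻¹ • (q - o), by rw [norm_smul, norm_inv, norm_norm, inv_mul_cancel₀ hm0.ne'],
      by rw [smul_smul, mul_inv_cancel₀ hm0.ne', one_smul]⟩
  obtain ⟨c₀, hc, hin, hT⟩ := h
  have key := fun (s : ℝ) (τ : E) => advance_of_shadowed (s := s) (τ := τ) hr hrD hD rfl hu hqu hm0
    hqD hc hin hT hfar'
  have hs₁0 := Real.sqrt_nonneg (‖c₀‖ ^ 2 + 1 / 4 * r ^ 2)
  have hs₂0 := Real.sqrt_nonneg (‖c₀‖ ^ 2 + 3 / 4 * r ^ 2)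
  have hs₁ := Real.sq_sqrt (by positivity : 0 ≤ ‖c₀‖ ^ 2 + 1 / 4 * r ^ 2)
  have hs₂ := Real.sq_sqrt (by positivity : 0 ≤ ‖c₀‖ ^ 2 + 3 / 4 * r ^ 2)
  set s₁ := √(‖c₀‖ ^ 2 + 1 / 4 * r ^ 2)
  set s₂ := √(‖c₀‖ ^ 2 + 3 / 4 * r ^ 2)
  have hr2 := sq_nonneg r
  have hβ0 : 0 ≤ r ^ 3 / (1024 * D ^ 3) := by positivity
  have hy0 : 0 ≤ r ^ 2 / (16 * D) := by positivity
  have h2 := (key s₂ 0 hs₂0 (by linarith) hs₂.le (by simp) (by simpa using hβ0)).2.2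
  have h12 : s₁ ≤ s₂ := le_of_sq_le_sq (by linarith) hs₂0
  refine ⟨u, ‖q - o‖, s₁, s₂, hu, hm0, hqD, by rw [← hqu, add_sub_cancel], hs₁0, ?_, h2, ?_⟩
  · have hs₂D : s₂ ≤ D := by linarith
    apply le_of_sq_sub hD0 hs₂D (h12.trans hs₂D) h12
    have : 2 * D * (r ^ 2 / (4 * D)) = r ^ 2 / 2 := by field_simp; ring
    linarith
  · rintro s ⟨hs1, hs2⟩ τ hτu hτ
    have hs0 : 0 ≤ s := hs₁0.trans hs1
    have e1 := pow_le_pow_left₀ hs₁0 hs1 2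
    have e2 := pow_le_pow_left₀ hs0 hs2 2
    obtain ⟨k1, k2, k3⟩ := key s τ hs0 (by linarith) (by linarith) hτu hτ
    have huu : ⟪u, u⟫ = 1 := by rw [real_inner_self_eq_norm_sq, hu]; norm_num
    have hi : ⟪s • u + τ, q - o⟫ = ‖q - o‖ * s := by
      rw [hqu, inner_smul_right, inner_add_left, inner_smul_left, huu, hτu, ← hqu]; simp
    have hn : ‖s • u + τ‖ ^ 2 = s ^ 2 + ‖τ‖ ^ 2 := by
      rw [norm_add_sq_real, inner_smul_left, real_inner_comm, hτu, norm_smul, hu,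
        Real.norm_eq_abs, mul_one, sq_abs]
      simp
    have hτ2 := pow_le_pow_left₀ (norm_nonneg _) hτ 2
    refine ⟨?_, ?_, ?_, ?_, ?_⟩
    · convert k1 using 2; abel
    · rwa [add_sub_cancel_left]
    · rw [add_sub_cancel_left, hi, hn]
      have := mul_le_mul_of_nonneg_right hτ2 (sq_nonneg ‖q - o‖)
      linarith
    · rw [add_sub_cancel_left, hi]; positivity
    · rw [add_sub_cancel_left, hi]; gcongr

end Region

/-! ### Volume of the region of good moves -/

section Volume

variable {d : ℕ}

/-- In an orthonormal basis that starts with `u`, a cylinder with axis direction `u` and radius `β`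
contains a box whose other sides are `2 * β / d`. -/
lemma ofReal_le_volume_of_cylinder_subset {o u : EuclideanSpace ℝ (Fin d)}
    (hu : ‖u‖ = 1) {s₁ s₂ β : ℝ} (hs : s₁ ≤ s₂) (hβ : 0 ≤ β) {S : Set (EuclideanSpace ℝ (Fin d))}
    (hS : ∀ s ∈ Set.Icc s₁ s₂, ∀ τ : EuclideanSpace ℝ (Fin d), ⟪τ, u⟫ = 0 → ‖τ‖ ≤ β →
      o + (s • u + τ) ∈ S) :
    ENNReal.ofReal ((s₂ - s₁) * (2 * β / d) ^ (d - 1)) ≤ volume S := by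
  obtain rfl | hd := d.eq_zero_or_pos
  · have : u = 0 := Subsingleton.elim _ _
    simp [this] at hu
  let i₀ : Fin d := ⟨0, hd⟩
  obtain ⟨b, hb⟩ := Orthonormal.exists_orthonormalBasis_extension_of_card_eq (𝕜 := ℝ)
    (E := EuclideanSpace ℝ (Fin d)) (ι := Fin d) (by simp) (v := fun _ => u) (s := {i₀})
    (by
      refine ⟨fun i => by simpa using hu, fun i j hij => ?_⟩
      exact absurd (Subtype.ext ((Set.mem_singleton_iff.1 i.2).trans
        (Set.mem_singleton_iff.1 j.2).symm)) hij)
  have hb0 : b i₀ = u := hb i₀ rfl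
  have hd' : (0 : ℝ) < d := by exact_mod_cast hd
  let lo : Fin d → ℝ := fun i => if i = i₀ then s₁ else -(β / d)
  let hi : Fin d → ℝ := fun i => if i = i₀ then s₂ else β / d
  have hbox : volume (Set.univ.pi fun i => Set.Icc (lo i) (hi i)) =
      ENNReal.ofReal ((s₂ - s₁) * (2 * β / d) ^ (d - 1)) := by
    rw [volume_pi, Measure.pi_pi]
    simp only [Real.volume_Icc]
    rw [← ENNReal.ofReal_prod_of_nonneg]
    · congr 1
      rw [← Finset.mul_prod_erase _ _ (Finset.mem_univ i₀)]
      have h0 : hi i₀ - lo i₀ = s₂ - s₁ := by simp [lo, hi]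
      rw [h0]
      congr 1
      · rw [Finset.prod_congr rfl (g := fun _ => 2 * β / d)]
        · simp [div_pow]
        · intro i hi'
          have := (Finset.mem_erase.1 hi').1
          simp only [lo, hi, if_neg this]; ring
    · intro i _
      by_cases h : i = i₀
      · simpa [lo, hi, h] using hs
      · simp only [lo, hi, if_neg h]
        have : 0 ≤ β / d := by positivity
        linarith
  have hmp : MeasurePreserving
      (fun x : EuclideanSpace ℝ (Fin d) => (MeasurableEquiv.toLp 2 (Fin d → ℝ)).symm (b.repr (x - o)))
      volume volume :=
    (EuclideanSpace.volume_preserving_symm_measurableEquiv_toLp (Fin d)).comp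
      (b.measurePreserving_repr.comp (measurePreserving_sub_right volume o))
  rw [← hbox, ← hmp.measure_preimage (MeasurableSet.univ_pi fun i =>
    measurableSet_Icc).nullMeasurableSet]
  apply measure_mono
  intro x hx
  have hx' : ∀ i, ⟪b i, x - o⟫ ∈ Set.Icc (lo i) (hi i) := by
    intro i
    have := hx i (Set.mem_univ i)
    rwa [← b.repr_apply_apply]
  set τ := ∑ i ∈ Finset.univ.erase i₀, ⟪b i, x - o⟫ • b i with hτ
  have hsum : x - o = ⟪b i₀, x - o⟫ • u + τ := by
    conv_lhs => rw [← b.sum_repr' (x - o), ← Finset.add_sum_erase _ _ (Finset.mem_univ i₀)]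
    rw [hb0]
  have hxe : x = o + (⟪b i₀, x - o⟫ • u + τ) := by rw [← hsum, add_sub_cancel]
  rw [hxe]
  apply hS
  · simpa [lo, hi] using hx' i₀
  · rw [hτ, sum_inner]
    apply Finset.sum_eq_zero
    intro i hi'
    rw [inner_smul_left, ← hb0, b.inner_eq_zero (Finset.mem_erase.1 hi').1, mul_zero]
  · calc ‖τ‖ ≤ ∑ i ∈ Finset.univ.erase i₀, ‖⟪b i, x - o⟫ • b i‖ := norm_sum_le _ _
      _ ≤ ∑ i ∈ Finset.univ.erase i₀, β / d := by
          apply Finset.sum_le_sum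
          intro i hi'
          have := hx' i
          simp only [lo, hi, if_neg (Finset.mem_erase.1 hi').1] at this
          rw [norm_smul, b.norm_eq_one, mul_one, Real.norm_eq_abs]
          exact abs_le.2 this
      _ ≤ ∑ i : Fin d, β / d :=
          Finset.sum_le_sum_of_subset_of_nonneg (Finset.erase_subset _ _)
            (fun _ _ _ => by positivity)
      _ = β := by simp; field_simp

lemma norm_sub_le_of_mem_unitCube {x z : EuclideanSpace ℝ (Fin d)} (hx : x ∈ unitCube d)
    (hz : z ∈ unitCube d) : ‖x - z‖ ≤ d := by
  have h : ‖x - z‖ ^ 2 ≤ d := by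
    rw [EuclideanSpace.norm_sq_eq]
    calc ∑ i, ‖(x - z) i‖ ^ 2 ≤ ∑ _i : Fin d, (1 : ℝ) := by
          apply Finset.sum_le_sum
          intro i _
          have : ‖(x - z) i‖ ≤ 1 := by
            rw [Real.norm_eq_abs, PiLp.sub_apply, abs_le]
            constructor <;> linarith [(hx i).1, (hx i).2, (hz i).1, (hz i).2]
          exact pow_le_one₀ (norm_nonneg _) this
      _ = d := by simp
  apply le_of_sq_le_sq (h.trans _) (by positivity)
  rw [← Nat.cast_pow]
  exact_mod_cast Nat.le_self_pow (by norm_num) d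

/-- The cube `[1/4, 3/4]^d`. A vertex in it serves as the origin of the pursuit. -/
def centralCube (d : ℕ) : Set (EuclideanSpace ℝ (Fin d)) :=
  {x | ∀ i, x i ∈ Set.Icc (1 / 4 : ℝ) (3 / 4)}

/-- The cube is star-shaped about a central point `o` with room to spare: it contains a ball of radius
proportional to `m - s` around the point at distance `s` on the segment of length `m` from `o` to a
point of the cube. So thin cylinders around the segment that stop short of its end stay in
the cube. -/
lemma ray_add_mem_unitCube {o u τ : EuclideanSpace ℝ (Fin d)} {m s : ℝ} (ho : o ∈ centralCube d)
    (hq : o + m • u ∈ unitCube d) (hm : 0 < m) (hs0 : 0 ≤ s) (hsm : s ≤ m)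
    (hτ : ‖τ‖ ≤ (m - s) / m / 4) : o + (s • u + τ) ∈ unitCube d := by
  intro i
  have hτi : |τ i| ≤ (m - s) / m / 4 := (PiLp.norm_apply_le τ i).trans hτ
  obtain ⟨h1, h2⟩ := abs_le.1 hτi
  obtain ⟨o1, o2⟩ := ho i
  obtain ⟨q1, q2⟩ := hq i
  simp only [PiLp.add_apply, PiLp.smul_apply, smul_eq_mul] at q1 q2 ⊢
  obtain ⟨t, ht⟩ : ∃ t, t = s / m := ⟨_, rfl⟩
  have hst : s = t * m := by rw [ht]; field_simp
  have ht0 : 0 ≤ t := by rw [ht]; positivity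
  have ht1 : t ≤ 1 := by rw [ht, div_le_one hm]; exact hsm
  have hmt : (m - s) / m = 1 - t := by rw [ht]; field_simp
  rw [hmt] at h1 h2
  have e1 : 0 ≤ t * (o i + m * u i) := mul_nonneg ht0 q1
  have e2 : t * (o i + m * u i) ≤ t * 1 := mul_le_mul_of_nonneg_left q2 ht0
  have e3 : (1 - t) * (1 / 4) ≤ (1 - t) * o i := mul_le_mul_of_nonneg_left o1 (by linarith)
  have e4 : (1 - t) * o i ≤ (1 - t) * (3 / 4) := mul_le_mul_of_nonneg_left o2 (by linarith)
  have e5 : o i + (s * u i + τ i) = t * (o i + m * u i) + (1 - t) * o i + τ i := by rw [hst]; ring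
  rw [e5]
  constructor <;> linarith

/-- The region of good moves has volume at least `advanceConst d * r ^ (3 * d - 1)`. The exponent is
`2 + 3 * (d - 1)`, from a cylinder of length of order `r ^ 2` and radius of order `r ^ 3`. -/
noncomputable def advanceConst (d : ℕ) : ℝ := 1 / (4 * d) * (1 / (512 * (d : ℝ) ^ 4)) ^ (d - 1)

lemma advanceConst_pos (hd : 0 < d) : 0 < advanceConst d := by
  have : (0 : ℝ) < d := by exact_mod_cast hd
  unfold advanceConst; positivity

lemma le_uniformCube_advanceRegion (hd : 0 < d) {r : ℝ} (hr : 0 < r) (hrd : r ≤ d)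
    {o c q : EuclideanSpace ℝ (Fin d)} (ho : o ∈ centralCube d) (hq : q ∈ unitCube d)
    (h : Shadowed r (r ^ 3 / (1024 * (d : ℝ) ^ 3)) (c - o) (q - o)) (hfar : r < ‖q - c‖) :
    ENNReal.ofReal (advanceConst d * r ^ (3 * d - 1)) ≤
      uniformCube d (advanceRegion r d o c q) := by
  have hd1 : (1 : ℝ) ≤ d := by exact_mod_cast hd
  have hd0 : (0 : ℝ) < d := by linarith
  have ho' : o ∈ unitCube d := fun i => ⟨by linarith [(ho i).1], by linarith [(ho i).2]⟩
  obtain ⟨u, m, s₁, s₂, hu, hm0, hmd, hqu, hs₁, h12, h2m, hcyl⟩ :=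
    exists_cylinder_subset_advanceRegion hr hrd hd1 (norm_sub_le_of_mem_unitCube hq ho') h hfar
  have hβ0 : 0 ≤ r ^ 3 / (1024 * (d : ℝ) ^ 3) := by positivity
  have hy0 : 0 ≤ r ^ 2 / (4 * (d : ℝ)) := by positivity
  have hy1 : 0 ≤ r ^ 2 / (16 * (d : ℝ)) := by positivity
  have hvol := ofReal_le_volume_of_cylinder_subset (o := o) (S := advanceRegion r d o c q ∩ unitCube d)
    hu (by linarith : s₁ ≤ s₂) hβ0 (fun s hs τ hτu hτ => ⟨hcyl s hs τ hτu hτ, by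
      refine ray_add_mem_unitCube ho (hqu ▸ hq) hm0 (hs₁.trans hs.1) (by linarith [hs.2])
        (hτ.trans ?_)
      have h1 : r ^ 2 / (16 * d) / d ≤ (m - s) / m :=
        div_le_div₀ (by linarith [hs.2]) (by linarith [hs.2]) hm0 hmd
      have h2 : r ^ 3 / (1024 * (d : ℝ) ^ 3) ≤ r ^ 2 / (16 * d) / d / 4 := by
        rw [div_div, div_div, div_le_div_iff₀ (by positivity) (by positivity)]
        have : r ^ 2 * d ^ 2 * r ≤ r ^ 2 * d ^ 2 * d := by gcongr
        have : 0 ≤ r ^ 2 * (d : ℝ) ^ 3 := by positivity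
        nlinarith
      linarith⟩)
  have hle : volume (advanceRegion r d o c q ∩ unitCube d) ≤ uniformCube d (advanceRegion r d o c q) :=
    Measure.le_restrict_apply _ _
  refine le_trans (ENNReal.ofReal_le_ofReal ?_) (hvol.trans hle)
  have he : 3 * d - 1 = 2 + 3 * (d - 1) := by omega
  have : advanceConst d * r ^ (3 * d - 1) =
      r ^ 2 / (4 * d) * (2 * (r ^ 3 / (1024 * (d : ℝ) ^ 3)) / d) ^ (d - 1) := by
    rw [he, pow_add, pow_mul, advanceConst]
    have : 2 * (r ^ 3 / (1024 * (d : ℝ) ^ 3)) / d = 1 / (512 * (d : ℝ) ^ 4) * r ^ 3 := by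
      field_simp; ring
    rw [this, mul_pow]; ring
  rw [this]
  gcongr

end Volume

/-! ### Random points hit all the regions -/

section Probability

/-- Among independent points of law `μ`, let those with indices in `P` determine a set `R`. The
probability that `R` has measure at least `p` and yet is missed by all the other points is at most
`(1 - p)` to their number: condition on the points with indices in `P`. -/
lemma measure_pi_avoid_le {ι α : Type*} [Fintype ι] [MeasurableSpace α] (μ : Measure α)
    [IsProbabilityMeasure μ] (P : ι → Prop) [DecidablePred P] (R : ({i // P i} → α) → Set α)
    (hR : MeasurableSet {w : ({i // P i} → α) × α | w.2 ∈ R w.1}) (p : ENNReal) :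
    Measure.pi (fun _ : ι => μ) {X | p ≤ μ (R fun i => X i) ∧ ∀ l, ¬ P l → X l ∉ R fun i => X i} ≤
      (1 - p) ^ Fintype.card {i // ¬ P i} := by
  have hmR : ∀ y, MeasurableSet (R y) := fun y => hR.preimage (measurable_const.prodMk measurable_id)
  let Z : Set (({i // P i} → α) × ({i // ¬ P i} → α)) :=
    {w | p ≤ μ (R w.1) ∧ ∀ l, w.2 l ∉ R w.1}
  have hZ : MeasurableSet Z := by
    have h1 : MeasurableSet {w : ({i // P i} → α) × ({i // ¬ P i} → α) | p ≤ μ (R w.1)} :=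
      measurableSet_le measurable_const ((measurable_measure_prodMk_left hR).comp measurable_fst)
    have h2 : ∀ l, MeasurableSet {w : ({i // P i} → α) × ({i // ¬ P i} → α) | w.2 l ∉ R w.1} :=
      fun l => (hR.preimage
        (measurable_fst.prodMk ((measurable_pi_apply l).comp measurable_snd))).compl
    have : Z = {w | p ≤ μ (R w.1)} ∩ ⋂ l, {w | w.2 l ∉ R w.1} := by
      ext w; simp [Z]
    rw [this]
    exact h1.inter (MeasurableSet.iInter h2)
  have hmp := measurePreserving_piEquivPiSubtypeProd (fun _ : ι => μ) P
  have heq : {X : ι → α | p ≤ μ (R fun i => X i) ∧ ∀ l, ¬ P l → X l ∉ R fun i => X i} =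
      (MeasurableEquiv.piEquivPiSubtypeProd (fun _ : ι => α) P) ⁻¹' Z := by
    ext X
    simp [Z, MeasurableEquiv.piEquivPiSubtypeProd, Equiv.piEquivPiSubtypeProd]
  rw [heq, hmp.measure_preimage hZ.nullMeasurableSet, Measure.prod_apply hZ]
  calc ∫⁻ y, (Measure.pi fun _ : {i // ¬ P i} => μ) (Prod.mk y ⁻¹' Z)
        ∂(Measure.pi fun _ : {i // P i} => μ)
      ≤ ∫⁻ _, (1 - p) ^ Fintype.card {i // ¬ P i} ∂(Measure.pi fun _ : {i // P i} => μ) := by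
        apply lintegral_mono
        intro y
        by_cases hy : p ≤ μ (R y)
        · have : Prod.mk y ⁻¹' Z = Set.univ.pi fun _ : {i // ¬ P i} => (R y)ᶜ := by
            ext z; simp [Z, hy]
          dsimp only
          rw [this, Measure.pi_pi, Finset.prod_const, Finset.card_univ,
            prob_compl_eq_one_sub (hmR y)]
          gcongr
        · have : Prod.mk y ⁻¹' Z = ∅ := by
            ext z; simp [Z, hy]
          dsimp only
          rw [this, measure_empty]
          exact zero_le
    _ = _ := by simp

lemma one_sub_ofReal_pow_le {p : ℝ} (hp : 0 ≤ p) (k : ℕ) :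
    (1 - ENNReal.ofReal p) ^ k ≤ ENNReal.ofReal (Real.exp (-(p * k))) := by
  have h : 1 - ENNReal.ofReal p ≤ ENNReal.ofReal (Real.exp (-p)) := by
    rw [← ENNReal.ofReal_one, ← ENNReal.ofReal_sub _ hp]
    apply ENNReal.ofReal_le_ofReal
    linarith [Real.add_one_le_exp (-p)]
  calc (1 - ENNReal.ofReal p) ^ k ≤ (ENNReal.ofReal (Real.exp (-p))) ^ k := by gcongr
    _ = _ := by
      rw [← ENNReal.ofReal_pow (Real.exp_pos _).le, ← Real.exp_nat_mul]
      congr 2; ring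

variable {d n : ℕ}

lemma measurableSet_advanceRegion (r D : ℝ) :
    MeasurableSet {w : (EuclideanSpace ℝ (Fin d) × EuclideanSpace ℝ (Fin d) ×
      EuclideanSpace ℝ (Fin d)) × EuclideanSpace ℝ (Fin d) |
        w.2 ∈ advanceRegion r D w.1.1 w.1.2.1 w.1.2.2} := by
  simp only [advanceRegion, Set.ofPred_and]
  refine .inter ?_ (.inter ?_ (.inter ?_ (.inter ?_ ?_)))
  all_goals
    refine (isClosed_le ?_ ?_).measurableSet <;> fun_prop

/-- For all vertices `i`, `j`, `k` as origin, cop and robber, if the region of good moves has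
probability at least `p`, then it contains a vertex. -/
def AdvanceHits (r D : ℝ) (p : ENNReal) (X : Fin n → EuclideanSpace ℝ (Fin d)) : Prop :=
  ∀ i j k, p ≤ uniformCube d (advanceRegion r D (X i) (X j) (X k)) →
    ∃ l, X l ∈ advanceRegion r D (X i) (X j) (X k)

/-- Union bound over the triples of origin, cop and robber. The exponent leaves out the at most three
points on which the region depends. -/
lemma pointsLaw_not_advanceHits_le (r D : ℝ) (p : ENNReal) :
    pointsLaw d n {X | ¬ AdvanceHits r D p X} ≤ n ^ 3 * (1 - p) ^ (n - 3) := by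
  have hcover : {X : Fin n → EuclideanSpace ℝ (Fin d) | ¬ AdvanceHits r D p X} ⊆
      ⋃ t : Fin n × Fin n × Fin n,
        {X | p ≤ uniformCube d (advanceRegion r D (X t.1) (X t.2.1) (X t.2.2)) ∧
          ∀ l, ¬ (l = t.1 ∨ l = t.2.1 ∨ l = t.2.2) →
            X l ∉ advanceRegion r D (X t.1) (X t.2.1) (X t.2.2)} := by
    intro X hX
    simp only [AdvanceHits, Set.mem_ofPred_eq, not_forall, not_exists] at hX
    obtain ⟨i, j, k, hp, hl⟩ := hX
    exact Set.mem_iUnion.2 ⟨(i, j, k), hp, fun l _ => hl l⟩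
  refine (measure_mono hcover).trans ((measure_iUnion_fintype_le _ _).trans ?_)
  have hb : ∀ t : Fin n × Fin n × Fin n, pointsLaw d n
      {X | p ≤ uniformCube d (advanceRegion r D (X t.1) (X t.2.1) (X t.2.2)) ∧
          ∀ l, ¬ (l = t.1 ∨ l = t.2.1 ∨ l = t.2.2) →
            X l ∉ advanceRegion r D (X t.1) (X t.2.1) (X t.2.2)} ≤ (1 - p) ^ (n - 3) := by
    rintro ⟨i, j, k⟩
    let P : Fin n → Prop := fun l => l = i ∨ l = j ∨ l = k
    have h := measure_pi_avoid_le (uniformCube d) P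
      (fun y => advanceRegion r D (y ⟨i, Or.inl rfl⟩) (y ⟨j, Or.inr (Or.inl rfl)⟩)
        (y ⟨k, Or.inr (Or.inr rfl)⟩))
      ((measurableSet_advanceRegion r D).preimage
        (f := fun w : ({l // P l} → EuclideanSpace ℝ (Fin d)) × EuclideanSpace ℝ (Fin d) =>
          ((w.1 ⟨i, Or.inl rfl⟩, w.1 ⟨j, Or.inr (Or.inl rfl)⟩, w.1 ⟨k, Or.inr (Or.inr rfl)⟩), w.2))
        (by fun_prop)) p
    refine h.trans (pow_le_pow_right_of_le_one' tsub_le_self ?_)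
    rw [Fintype.card_subtype_compl, Fintype.card_fin]
    apply Nat.sub_le_sub_left
    rw [Fintype.card_subtype]
    refine (Finset.card_le_card (t := {i, j, k}) ?_).trans Finset.card_le_three
    intro l hl
    simpa [P] using hl
  refine (Finset.sum_le_sum fun t _ => hb t).trans ?_
  simp only [Finset.sum_const, Finset.card_univ, Fintype.card_prod, Fintype.card_fin, nsmul_eq_mul]
  push_cast
  apply le_of_eq; ring

lemma pointsLaw_not_forall_mem_unitCube :
    pointsLaw d n {X | ¬ ∀ i, X i ∈ unitCube d} = 0 := by
  have h : ∀ i, ∀ᵐ X ∂(pointsLaw d n), X i ∈ unitCube d := by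
    intro i
    have h0 : ∀ᵐ x ∂(uniformCube d), x ∈ unitCube d := by
      apply ae_restrict_mem
      have : unitCube d = ⋂ i, {x | x i ∈ Set.Icc (0 : ℝ) 1} := by ext; simp [unitCube]
      rw [this]
      exact MeasurableSet.iInter fun i => measurableSet_Icc.preimage (by fun_prop)
    exact (measurePreserving_eval (fun _ : Fin n => uniformCube d) i).quasiMeasurePreserving.ae h0
  exact ae_all_iff.2 h

lemma uniformCube_centralCube (d : ℕ) : uniformCube d (centralCube d) = ENNReal.ofReal ((1 / 2) ^ d) := by
  have hsub : centralCube d ⊆ unitCube d := fun x hx i =>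
    ⟨by linarith [(hx i).1], by linarith [(hx i).2]⟩
  have h := (EuclideanSpace.volume_preserving_symm_measurableEquiv_toLp (Fin d))
  have e : centralCube d = (MeasurableEquiv.toLp 2 (Fin d → ℝ)).symm ⁻¹'
      (Set.univ.pi fun _ : Fin d => Set.Icc (1 / 4 : ℝ) (3 / 4)) := by
    ext x
    simp [centralCube, Pi.le_def, forall_and]
  rw [uniformCube, Measure.restrict_eq_self _ hsub, e, h.measure_preimage_equiv, volume_pi,
    Measure.pi_pi]
  simp only [Real.volume_Icc, Finset.prod_const, Finset.card_univ, Fintype.card_fin]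
  rw [← ENNReal.ofReal_pow (by norm_num)]
  norm_num

lemma pointsLaw_no_central_le :
    pointsLaw d n {X | ¬ ∃ i, X i ∈ centralCube d} ≤
      ENNReal.ofReal (Real.exp (-((1 / 2) ^ d * n))) := by
  have : {X : Fin n → EuclideanSpace ℝ (Fin d) | ¬ ∃ i, X i ∈ centralCube d} =
      Set.univ.pi fun _ => (centralCube d)ᶜ := by
    ext X; simp
  have hm : MeasurableSet (centralCube d) := by
    have : centralCube d = ⋂ i, {x | x i ∈ Set.Icc (1 / 4 : ℝ) (3 / 4)} := by ext; simp [centralCube]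
    rw [this]
    exact MeasurableSet.iInter fun i => measurableSet_Icc.preimage (by fun_prop)
  rw [this, pointsLaw, Measure.pi_pi, Finset.prod_const, Finset.card_univ, Fintype.card_fin,
    prob_compl_eq_one_sub hm, uniformCube_centralCube]
  exact one_sub_ofReal_pow_le (by positivity) n

lemma tendsto_union_bound {p : ℕ → ℝ}
    (hp : ∀ᶠ n : ℕ in atTop, 8 * (Real.log n / n) ≤ p n) :
    Tendsto (fun n : ℕ => (n : ENNReal) ^ 3 * (1 - ENNReal.ofReal (p n)) ^ (n - 3)) atTop (𝓝 0) := by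
  have hlim : Tendsto (fun n : ℕ => ENNReal.ofReal ((n : ℝ)⁻¹)) atTop (𝓝 0) := by
    rw [← ENNReal.ofReal_zero]
    exact ENNReal.tendsto_ofReal tendsto_inv_atTop_nhds_zero_nat
  refine tendsto_of_tendsto_of_tendsto_of_le_of_le' tendsto_const_nhds hlim
    (Eventually.of_forall fun _ => zero_le) ?_
  filter_upwards [hp, eventually_ge_atTop 6] with n hn h6
  have hn0 : (0 : ℝ) < n := by exact_mod_cast (by omega : 0 < n)
  have hlog : 0 ≤ Real.log n := Real.log_nonneg (by exact_mod_cast (by omega : 1 ≤ n))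
  have hp0 : 0 ≤ p n := le_trans (by positivity) hn
  have h4 : 4 * Real.log n ≤ p n * ((n - 3 : ℕ) : ℝ) := by
    have hh : (n : ℝ) / 2 ≤ ((n - 3 : ℕ) : ℝ) := by
      rw [Nat.cast_sub (by omega)]
      have : (6 : ℝ) ≤ n := by exact_mod_cast h6
      push_cast; linarith
    calc 4 * Real.log n = 8 * (Real.log n / n) * (n / 2) := by field_simp; ring
      _ ≤ p n * ((n - 3 : ℕ) : ℝ) := by gcongr
  calc (n : ENNReal) ^ 3 * (1 - ENNReal.ofReal (p n)) ^ (n - 3)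
      ≤ ENNReal.ofReal ((n : ℝ) ^ 3) * ENNReal.ofReal (Real.exp (-(p n * (n - 3 : ℕ)))) := by
        gcongr
        · rw [ENNReal.ofReal_pow hn0.le, ENNReal.ofReal_natCast]
        · exact one_sub_ofReal_pow_le hp0 _
    _ = ENNReal.ofReal ((n : ℝ) ^ 3 * Real.exp (-(p n * (n - 3 : ℕ)))) :=
        (ENNReal.ofReal_mul (by positivity)).symm
    _ ≤ ENNReal.ofReal ((n : ℝ)⁻¹) := by
        apply ENNReal.ofReal_le_ofReal
        calc (n : ℝ) ^ 3 * Real.exp (-(p n * (n - 3 : ℕ)))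
            ≤ (n : ℝ) ^ 3 * Real.exp (-(4 * Real.log n)) := by gcongr
          _ = (n : ℝ)⁻¹ := by
            have : Real.exp (-(4 * Real.log n)) = ((n : ℝ) ^ 4)⁻¹ := by
              rw [Real.exp_neg, ← Nat.cast_ofNat (R := ℝ) (n := 4), Real.exp_nat_mul, Real.exp_log hn0]
            rw [this]; field_simp

lemma tendsto_pointsLaw_no_central :
    Tendsto (fun n : ℕ => pointsLaw d n {X | ¬ ∃ i, X i ∈ centralCube d}) atTop (𝓝 0) := by
  have hlim : Tendsto (fun n : ℕ => ENNReal.ofReal (Real.exp (-((1 / 2) ^ d * n)))) atTop (𝓝 0) := by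
    rw [← ENNReal.ofReal_zero]
    refine ENNReal.tendsto_ofReal (Real.tendsto_exp_neg_atTop_nhds_zero.comp ?_)
    exact tendsto_natCast_atTop_atTop.const_mul_atTop (by positivity)
  exact tendsto_of_tendsto_of_tendsto_of_le_of_le tendsto_const_nhds hlim
    (fun _ => zero_le) (fun _ => pointsLaw_no_central_le)

end Probability

end RandomGeometric

/-! ### The strategy of the cop -/

namespace CopsRobbers

section Pursuit

variable {V : Type*} {G : SimpleGraph V}

/-- The position after `t` moves of a cop who starts at `v` and answers his own position `c` and
the robber's position `q` by moving to `next c q`. -/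
def pursuit (next : V → V → V) (v : V) : (t : ℕ) → (Fin t → V) → V
  | 0, _ => v
  | t + 1, h => next (pursuit next v t fun j => h j.castSucc) (h (Fin.last t))

/-- The strategy of a single cop given by a memoryless rule `next`. -/
def pursuitStrategy (next : V → V → V) (hnext : ∀ c q, Step G c (next c q)) (v : V) :
    CopStrategy G 1 where
  pos t h _ := pursuit next v t h
  legal _ _ _ := hnext _ _

lemma copNumber_eq_one_of_copsWinWithin [Nonempty V] {T : ℕ} (h : CopsWinWithin G 1 T) :
    copNumber G = 1 := by
  obtain ⟨s, hs⟩ := h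
  have h1 : CopsWin G 1 := ⟨s, fun ρ hρ => ⟨T, hs ρ hρ⟩⟩
  have h0 : ¬ CopsWin G 0 := by
    rintro ⟨s₀, hs₀⟩
    obtain ⟨v⟩ := ‹Nonempty V›
    obtain ⟨T, ⟨_, _, i, _⟩ | ⟨_, _, i, _⟩⟩ := hs₀ (fun _ => v) (fun _ => Or.inl rfl)
    · exact i.elim0
    · exact i.elim0
  apply le_antisymm (Nat.sInf_le h1)
  refine le_csInf ⟨1, h1⟩ fun k hk => ?_
  rcases Nat.eq_zero_or_pos k with rfl | hk0
  · exact absurd hk h0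
  · exact hk0

end Pursuit

end CopsRobbers

namespace RandomGeometric

open CopsRobbers
open scoped RealInnerProductSpace

variable {d n : ℕ}

open Classical in
/-- The rule of the cop: capture the robber if he is in reach, else move to some vertex in the region
of good moves if there is one, else stay put. -/
noncomputable def advance (X : Fin n → EuclideanSpace ℝ (Fin d)) (r : ℝ) (o c q : Fin n) : Fin n :=
  if dist (X c) (X q) ≤ r then q
  else if h : ∃ l, X l ∈ advanceRegion r d (X o) (X c) (X q) then h.choose else c

lemma step_advance (X : Fin n → EuclideanSpace ℝ (Fin d)) (r : ℝ) (o c q : Fin n) :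
    Step (geometricGraph X r) c (advance X r o c q) := by
  unfold advance
  split_ifs with h1 h2
  · by_cases h : q = c
    · exact Or.inl h
    · exact Or.inr ⟨Ne.symm h, h1⟩
  · by_cases h : h2.choose = c
    · exact Or.inl h
    · refine Or.inr ⟨Ne.symm h, ?_⟩
      rw [dist_comm, dist_eq_norm]
      exact h2.choose_spec.1
  · exact Or.inl rfl

lemma advance_mem {X : Fin n → EuclideanSpace ℝ (Fin d)} {r : ℝ} {o c q : Fin n}
    (hfar : ¬ dist (X c) (X q) ≤ r) (h : ∃ l, X l ∈ advanceRegion r d (X o) (X c) (X q)) :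
    X (advance X r o c q) ∈ advanceRegion r d (X o) (X c) (X q) := by
  rw [advance, if_neg hfar, dif_pos h]
  exact h.choose_spec

lemma dist_le_of_step {X : Fin n → EuclideanSpace ℝ (Fin d)} {r : ℝ} (hr : 0 ≤ r) {u v : Fin n}
    (h : Step (geometricGraph X r) u v) : ‖X v - X u‖ ≤ r := by
  rcases h with rfl | h
  · simpa using hr
  · rw [← dist_eq_norm, dist_comm]; exact h.2

/-- On points of the cube with a central vertex, such that every large region of good moves contains a
vertex, the cop wins: as long as the robber is not caught he stays shadowed, and the distance
of the cop from the central vertex grows by `r ^ 2 / (16 * d)` in each round, while it cannot exceed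
the diameter of the cube. -/
theorem copsWinWithin_geometricGraph (hd : 0 < d) {r : ℝ} (hr : 0 < r)
    {X : Fin n → EuclideanSpace ℝ (Fin d)} (hX : ∀ i, X i ∈ unitCube d)
    (hcentral : ∃ i, X i ∈ centralCube d)
    (hhits : AdvanceHits r d (ENNReal.ofReal (advanceConst d * r ^ (3 * d - 1))) X) :
    CopsWinWithin (geometricGraph X r) 1 ⌈17 * (d : ℝ) ^ 2 / r ^ 2⌉₊ := by
  obtain ⟨o, ho⟩ := hcentral
  have hd1 : (1 : ℝ) ≤ d := by exact_mod_cast hd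
  have hd0 : (0 : ℝ) < d := by linarith
  obtain ⟨T, hT⟩ : ∃ T, T = ⌈17 * (d : ℝ) ^ 2 / r ^ 2⌉₊ := ⟨_, rfl⟩
  rw [← hT]
  have hT1 : 0 < T := by rw [hT, Nat.ceil_pos]; positivity
  refine ⟨pursuitStrategy (advance X r o) (step_advance X r o) o, fun ρ hρ => ?_⟩
  by_contra hcaught
  set c : ℕ → Fin n := fun t => pursuit (advance X r o) o t fun j : Fin t => ρ j with hc
  have hc0 : c 0 = o := rfl
  have hcs : ∀ t, c (t + 1) = advance X r o (c t) (ρ t) := fun t => rfl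
  have hfar : ∀ t < T, ¬ dist (X (c t)) (X (ρ t)) ≤ r := by
    intro t ht hle
    refine hcaught (Or.inr ⟨t, ht, 0, ?_⟩)
    change c (t + 1) = ρ t
    rw [hcs, advance, if_pos hle]
  have hfar' : ∀ t < T, r < ‖X (ρ t) - X (c t)‖ := by
    intro t ht
    have := hfar t ht
    rwa [dist_comm, dist_eq_norm, not_le] at this
  -- For `r > d` everything is in reach, and the cop wins with his first move.
  have hrd : r ≤ d := (hfar' 0 hT1).le.trans (norm_sub_le_of_mem_unitCube (hX _) (hX _))
  set β := r ^ 3 / (1024 * (d : ℝ) ^ 3) with hβ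
  have hβ0 : 0 ≤ β := by positivity
  have hy : 0 < r ^ 2 / (16 * (d : ℝ)) := by positivity
  have hβr : β ≤ r := (tubeRadius_le hr hrd hd1).trans (by linarith)
  have hyβ : 2 * r * β ≤ (r ^ 2 / (16 * (d : ℝ))) ^ 2 := by
    rw [hβ, div_pow, mul_div_assoc', div_le_div_iff₀ (by positivity) (by positivity)]
    have h1 : (d : ℝ) ^ 2 ≤ (d : ℝ) ^ 3 := pow_le_pow_right₀ hd1 (by norm_num)
    have h2 : r ^ 4 * (d : ℝ) ^ 2 ≤ r ^ 4 * (d : ℝ) ^ 3 := by gcongr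
    have h3 : 0 ≤ r ^ 4 * (d : ℝ) ^ 3 := by positivity
    nlinarith
  have hstep : ∀ t < T, Shadowed r β (X (c t) - X o) (X (ρ t) - X o) →
      X (c (t + 1)) ∈ advanceRegion r d (X o) (X (c t)) (X (ρ t)) := fun t ht hsh =>
    advance_mem (hfar t ht) (hhits o (c t) (ρ t)
      (le_uniformCube_advanceRegion hd hr hrd ho (hX _) hsh (hfar' t ht)))
  have hinv : ∀ t < T, Shadowed r β (X (c t) - X o) (X (ρ t) - X o) ∧
      t * (r ^ 2 / (16 * (d : ℝ))) ≤ ‖X (c t) - X o‖ := by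
    intro t
    induction t with
    | zero =>
      intro _
      rw [hc0, sub_self]
      exact ⟨shadowed_zero hβ0 _, by simp⟩
    | succ t ih =>
      intro ht
      obtain ⟨hsh, hpot⟩ := ih (by omega)
      obtain ⟨-, hgain, hline, hin0, hin1⟩ := hstep t (by omega) hsh
      have hq0 : X (ρ t) - X o ≠ 0 := norm_pos_iff.1 (pos_norm_of_shadowed hr hrd hd1 hsh
        (by rw [sub_sub_sub_cancel_right]; exact hfar' t (by omega)))
      refine ⟨shadowed_of_robber_move hβ0 hβr hy hyβ hq0 hline hin0 hin1 ?_ ?_, ?_⟩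
      · rw [sub_sub_sub_cancel_right]; exact dist_le_of_step hr.le (hρ t)
      · rw [sub_sub_sub_cancel_right]; exact hfar' (t + 1) ht
      · push_cast; linarith
  obtain ⟨t, rfl⟩ : ∃ t, T = t + 1 := ⟨T - 1, by omega⟩
  obtain ⟨hsh, hpot⟩ := hinv t (by omega)
  obtain ⟨-, hgain, -⟩ := hstep t (by omega) hsh
  have hub : ‖X (c (t + 1)) - X o‖ ≤ d := norm_sub_le_of_mem_unitCube (hX _) (hX _)
  have hle : 17 * (d : ℝ) ^ 2 / r ^ 2 ≤ (t + 1 : ℕ) := by rw [hT]; exact Nat.le_ceil _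
  have h1 : 17 * (d : ℝ) ^ 2 / r ^ 2 * (r ^ 2 / (16 * d)) ≤ (t + 1 : ℕ) * (r ^ 2 / (16 * d)) := by
    gcongr
  have h2 : 17 * (d : ℝ) ^ 2 / r ^ 2 * (r ^ 2 / (16 * d)) = 17 / 16 * d := by field_simp
  push_cast at h1
  linarith

/-- The sets `A n` need not be measurable: the bound is by outer measure. -/
lemma tendsto_one_of_compl_subset {Ω : ℕ → Type*} [∀ n, MeasurableSpace (Ω n)]
    (μ : ∀ n, Measure (Ω n)) [∀ n, IsProbabilityMeasure (μ n)] {A B : ∀ n, Set (Ω n)}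
    (h : ∀ᶠ n in atTop, (A n)ᶜ ⊆ B n) (hB : Tendsto (fun n => μ n (B n)) atTop (𝓝 0)) :
    Tendsto (fun n => μ n (A n)) atTop (𝓝 1) := by
  have hlim : Tendsto (fun n => 1 - μ n (B n)) atTop (𝓝 1) := by
    simpa using ENNReal.Tendsto.sub (tendsto_const_nhds (x := (1 : ENNReal))) hB (Or.inl (by simp))
  refine tendsto_of_tendsto_of_tendsto_of_le_of_le' hlim tendsto_const_nhds ?_
    (Eventually.of_forall fun n => prob_le_one)
  filter_upwards [h] with n hn
  rw [tsub_le_iff_right]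
  calc (1 : ENNReal) = μ n Set.univ := measure_univ.symm
    _ ≤ μ n (A n ∪ B n) := measure_mono fun x _ => by
        by_cases hx : x ∈ A n
        · exact Or.inl hx
        · exact Or.inr (hn hx)
    _ ≤ _ := measure_union_le _ _

instance isProbabilityMeasure_pointsLaw (d n : ℕ) : IsProbabilityMeasure (pointsLaw d n) := by
  unfold pointsLaw; infer_instance

end RandomGeometric

/-! ### Conclusion -/

theorem theorem2p2 (d : ℕ) (hd : 1 < d) :
    ∃ c : ℝ, 0 < c ∧ ∃ K : ℝ, 0 < K ∧
      ∀ r : ℕ → ℝ,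
        (∀ᶠ n : ℕ in atTop, 0 < r n ∧ c * (Real.log n / n) < r n ^ (3 * d - 1)) →
          Tendsto
            (fun n : ℕ => RandomGeometric.pointsLaw d n
              {X | CopsRobbers.copNumber (RandomGeometric.geometricGraph X (r n)) = 1})
            atTop (𝓝 1) ∧
          Tendsto
            (fun n : ℕ => RandomGeometric.pointsLaw d n
              {X | CopsRobbers.CopsWinWithin (RandomGeometric.geometricGraph X (r n)) 1
                ⌈K / r n ^ 2⌉₊})
            atTop (𝓝 1) := by
  have hd0 : 0 < d := by omega
  have hκ := RandomGeometric.advanceConst_pos hd0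
  set κ := RandomGeometric.advanceConst d
  refine ⟨8 / κ, by positivity, 17 * (d : ℝ) ^ 2, by positivity, fun r hr => ?_⟩
  let p : ℕ → ℝ := fun n => κ * r n ^ (3 * d - 1)
  let bad : (n : ℕ) → Set (Fin n → EuclideanSpace ℝ (Fin d)) := fun n =>
    {X | ¬ ∀ i, X i ∈ RandomGeometric.unitCube d} ∪
      ({X | ¬ ∃ i, X i ∈ RandomGeometric.centralCube d} ∪
        {X | ¬ RandomGeometric.AdvanceHits (r n) d (ENNReal.ofReal (p n)) X})
  have hp : ∀ᶠ n : ℕ in atTop, 8 * (Real.log n / n) ≤ p n := by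
    filter_upwards [hr] with n hn
    calc 8 * (Real.log n / n) = κ * (8 / κ * (Real.log n / n)) := by field_simp
      _ ≤ p n := mul_le_mul_of_nonneg_left hn.2.le hκ.le
  have hbad : Tendsto (fun n => RandomGeometric.pointsLaw d n (bad n)) atTop (𝓝 0) := by
    have hsum := (RandomGeometric.tendsto_pointsLaw_no_central (d := d)).add
      (RandomGeometric.tendsto_union_bound hp)
    rw [add_zero] at hsum
    refine tendsto_of_tendsto_of_tendsto_of_le_of_le tendsto_const_nhds hsum
      (fun _ => zero_le) fun n => ?_
    refine (measure_union_le _ _).trans ?_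
    rw [RandomGeometric.pointsLaw_not_forall_mem_unitCube, zero_add]
    refine (measure_union_le _ _).trans ?_
    gcongr
    exact RandomGeometric.pointsLaw_not_advanceHits_le _ _ _
  have hwin : ∀ᶠ n : ℕ in atTop, ∀ X ∉ bad n,
      CopsRobbers.CopsWinWithin (RandomGeometric.geometricGraph X (r n)) 1
        ⌈17 * (d : ℝ) ^ 2 / r n ^ 2⌉₊ := by
    filter_upwards [hr] with n hn X hX
    simp only [bad, Set.mem_union, Set.mem_ofPred_eq, not_or, not_not] at hX
    exact RandomGeometric.copsWinWithin_geometricGraph hd0 hn.1 hX.1 hX.2.1 hX.2.2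
  refine ⟨RandomGeometric.tendsto_one_of_compl_subset _ ?_ hbad,
    RandomGeometric.tendsto_one_of_compl_subset _ ?_ hbad⟩
  · filter_upwards [hwin, eventually_gt_atTop 0] with n hn hn0 X hX
    by_contra hb
    have : Nonempty (Fin n) := ⟨⟨0, hn0⟩⟩
    exact hX (CopsRobbers.copNumber_eq_one_of_copsWinWithin (hn X hb))
  · filter_upwards [hwin] with n hn X hX
    by_contra hb
    exact hX (hn X hb)
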